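/- **Theorem 3.14 (uniform monotonicity with a convex modulus is dominant).** Let $\mathcal H$ be a real Hilbert space, $\mu>0$, $n\ge 1$, $I=\{1,\dots,n\}$, and let $\lambda_i>0$ $(i\in I)$ with $\sum_{i\in I}\lambda_i=1$. A set-valued mapping $A:\mathcal H\rightrightarrows\mathcal H$ is *monotone with modulus* $\phi:[0,\infty[\,\to[0,\infty]$ if $\phi(\|x-y\|)\le\langle u-v,x-y\rangle$ whenever $u\in Ax$ and $v\in Ay$; it is $\phi$-*uniformly monotone* if, in addition, $\phi(t)=0\Leftrightarrow t=0$ for all $t\ge0$. A modulus $\phi$ is identified with its symmetric extension $t\mapsto\phi(|t|)$ to $\mathbb R$. For mappings $\mathbf A=(A_1,\dots,A_n)$, $A_i:\mathcal H\rightrightarrows\mathcal H$, the *resolvent average* is $$\mathcal R_\mu(\mathbf A,\boldsymbol\lambda)=\Big(\sum_{i\in I}\lambda_i\big(A_i+\mu^{-1}\mathrm{Id}\big)^{-1}\Big)^{-1}-\mu^{-1}\mathrm{Id},$$ and for functions $\mathbf f=(f_1,\dots,f_n)$, $f_i:\mathbb R\to\,]-\infty,+\infty]$, the *proximal average* with parameter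 $\nu>0$ is $$p_\nu(\mathbf f,\boldsymbol\lambda)(t)=\frac1\nu\Big(-\frac12 t^2+\inf_{\sum_{i\in I}t_i=t}\ \sum_{i\in I}\lambda_i\Big(\nu f_i(t_i/\lambda_i)+\frac12(t_i/\lambda_i)^2\Big)\Big),\qquad t\in\mathbb R.$$ Suppose that each $A_i:\mathcal H\rightrightarrows\mathcal H$ is maximally monotone and monotone with modulus $\phi_i:[0,\infty[\,\to[0,\infty]$, where $\phi_i$ is lower semicontinuous and convex. Set $\boldsymbol\phi=(\phi_1,\dots,\phi_n)$. Then $\phi=p_{\mu/2}(\boldsymbol\phi,\boldsymbol\lambda)$ is an even, $[0,\infty]$-valued, lower semicontinuous and convex function on $\mathbb R$ (thus the symmetric extension of a modulus), and $\mathcal R_\mu(\mathbf A,\boldsymbol\lambda)$ is monotone with modulus $\phi$. In particular, if there is $i_0\in I$ such that $A_{i_0}$ is $\phi_{i_0}$-uniformly monotone, then $\mathcal R_\mu(\mathbf A,\boldsymbol\lambda)$ is $\phi$-uniformly monotone. -/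

import Mathlib

open scoped NNReal ENNReal Pointwise

namespace ResolventAverage

section Operators

variable {H : Type*} [NormedAddCommGroup H] [InnerProductSpace ℝ H]

/-- The inverse of a set-valued mapping `A : H ⇉ H`: `x ∈ A⁻¹ u ↔ u ∈ A x`. -/
def inverse (A : H → Set H) : H → Set H := fun u => {x | u ∈ A x}

/-- `A` is monotone: `⟪x - y, u - v⟫ ≥ 0` for all `(x, u), (y, v)` in the graph of `A`. -/
def IsMonotone (A : H → Set H) : Prop :=
  ∀ x y u v : H, u ∈ A x → v ∈ A y → 0 ≤ inner ℝ (x - y) (u - v)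

/-- `A` is maximally monotone: it is monotone and its graph is not properly contained in the
graph of a monotone mapping. -/
def IsMaximallyMonotone (A : H → Set H) : Prop :=
  IsMonotone A ∧ ∀ B : H → Set H, IsMonotone B → (∀ x, A x ⊆ B x) → B = A

/-- `A` is monotone with modulus `φ : [0, ∞[ → [0, ∞]`: `φ ‖x - y‖ ≤ ⟪u - v, x - y⟫` for all
`(x, u), (y, v)` in the graph of `A` (an inequality between extended real numbers). -/
def IsMonotoneWithModulus (A : H → Set H) (φ : ℝ≥0 → ℝ≥0∞) : Prop :=
  ∀ x y u v : H, u ∈ A x → v ∈ A y →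
    ((φ ‖x - y‖₊ : ℝ≥0∞) : EReal) ≤ ((inner ℝ (u - v) (x - y) : ℝ) : EReal)

/-- `A` is `φ`-uniformly monotone: monotone with a modulus `φ` that vanishes exactly at `0`. -/
def IsUniformlyMonotone (A : H → Set H) (φ : ℝ≥0 → ℝ≥0∞) : Prop :=
  IsMonotoneWithModulus A φ ∧ ∀ t : ℝ≥0, φ t = 0 ↔ t = 0

/-- The set-valued mapping `A + c Id`, i.e. `x ↦ A x + c x`. -/
def addScalarId (A : H → Set H) (c : ℝ) : H → Set H := fun x => A x + {c • x}

/-- The resolvent average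
`R_μ(A, w) = (∑ i, w i (A i + μ⁻¹ Id)⁻¹)⁻¹ - μ⁻¹ Id`, where sums and scalar multiples of
set-valued mappings are the pointwise Minkowski ones. -/
def resolventAverage {ι : Type*} [Fintype ι] (μ : ℝ) (A : ι → H → Set H) (w : ι → ℝ) :
    H → Set H :=
  addScalarId (inverse fun u => ∑ i, w i • inverse (addScalarId (A i) μ⁻¹) u) (-μ⁻¹)

/-- The proximal average of extended-real-valued functions
`p_μ(f, w)(x) = μ⁻¹ (-½‖x‖² + inf_{∑ x_i = x} ∑ i, w i (μ f_i(x_i / w_i) + ½‖x_i / w_i‖²))`.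
It is meant for functions that do not take the value `-∞`, positive weights and `μ > 0`. -/
noncomputable def proximalAverage {ι : Type*} [Fintype ι] (μ : ℝ) (f : ι → H → EReal)
    (w : ι → ℝ) (x : H) : EReal :=
  ((1 / μ : ℝ) : EReal) *
    (((-(1 / 2) * ‖x‖ ^ 2 : ℝ) : EReal) +
      ⨅ z : {z : ι → H // ∑ i, z i = x},
        ∑ i, (w i : EReal) *
          ((μ : EReal) * f i ((w i)⁻¹ • z.1 i) +
            ((1 / 2 * ‖(w i)⁻¹ • z.1 i‖ ^ 2 : ℝ) : EReal)))

end Operators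

/-- The symmetric extension `t ↦ φ |t|` of a modulus `φ : [0, ∞[ → [0, ∞]` to the real line. -/
def symmetricExtension (φ : ℝ≥0 → ℝ≥0∞) : ℝ → ℝ≥0∞ := fun t => φ ‖t‖₊

end ResolventAverage

/-! Put `t i = w i * (t + δ i)` in the proximal average. Since the `δ i` have weighted mean zero,
expanding the squares cancels `-t² / 2`, and the average becomes the infimum of `∑ i, w i * (e i (t
+ δ i) + μ⁻¹ * δ i ^ 2)`, a sum of nonnegative terms (`proximalAverage_eq`). Convexity is that of a
marginal of a jointly convex function; lower semicontinuity follows from coercivity in `δ`.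

For the operators, two points of the graph of the resolvent average split into points of the `A i`
with differences `d i` of weighted mean `m`. Averaging the inequalities of the `A i` and using the
variance identity bounds `⟪u - v, m⟫` below by `∑ i, w i * (φ i ‖d i‖ + μ⁻¹ * ‖d i - m‖ ^ 2)`.
Projecting the `d i` onto the direction of `m` turns this into a scalar cost at `‖m‖`
(`averageModulus_norm_le`). -/

namespace ResolventAverage

open Finset Filter Topology

/-! ### Moduli and their symmetric extensions -/

section Modulus

variable {H : Type*} [NormedAddCommGroup H] [InnerProductSpace ℝ H]

/-- An empty graph would be properly contained in the monotone graph `{(0, 0)}`. This is what forces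
each modulus to vanish at `0`. -/
theorem IsMaximallyMonotone.exists_mem {A : H → Set H} (hA : IsMaximallyMonotone A) :
    ∃ x u, u ∈ A x := by
  by_contra! h
  have hB : (fun x : H => {_u : H | x = 0 ∧ _u = 0}) = A := by
    refine hA.2 _ ?_ fun x u hu => absurd hu (h x u)
    rintro x y u v ⟨rfl, rfl⟩ ⟨rfl, rfl⟩
    simp
  refine h 0 0 ?_
  rw [← hB]
  exact ⟨rfl, rfl⟩

theorem IsMonotoneWithModulus.apply_zero {A : H → Set H} {φ : ℝ≥0 → ℝ≥0∞}
    (h : IsMonotoneWithModulus A φ) (hA : ∃ x u, u ∈ A x) : φ 0 = 0 := by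
  obtain ⟨x, u, hu⟩ := hA
  have := h x x u u hu hu
  simp only [sub_self, nnnorm_zero, inner_zero_left, EReal.coe_zero] at this
  exact nonpos_iff_eq_zero.1 (by exact_mod_cast this)

theorem monotone_of_convexOn {φ : ℝ≥0 → ℝ≥0∞} (hφ : ConvexOn ℝ≥0 Set.univ φ) (h0 : φ 0 = 0) :
    Monotone φ := by
  intro s t hst
  rcases eq_or_ne t 0 with rfl | ht
  · rw [nonpos_iff_eq_zero.1 hst]
  have hle : s / t ≤ 1 := div_le_one_of_le₀ hst zero_le
  have h := hφ.2 (Set.mem_univ t) (Set.mem_univ 0) (zero_le (a := s / t))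
    (zero_le (a := 1 - s / t)) (add_tsub_cancel_of_le hle)
  simp only [smul_eq_mul, mul_zero, add_zero, h0, smul_zero, div_mul_cancel₀ _ ht] at h
  refine h.trans ?_
  rw [ENNReal.smul_def, smul_eq_mul]
  exact mul_le_of_le_one_left zero_le (by exact_mod_cast hle)

theorem symmetricExtension_neg (φ : ℝ≥0 → ℝ≥0∞) (t : ℝ) :
    symmetricExtension φ (-t) = symmetricExtension φ t := by
  simp [symmetricExtension]

theorem symmetricExtension_le {φ : ℝ≥0 → ℝ≥0∞} (hφ : Monotone φ) {s t : ℝ} (h : |s| ≤ |t|) :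
    symmetricExtension φ s ≤ symmetricExtension φ t :=
  hφ (by simpa [← NNReal.coe_le_coe] using h)

theorem symmetricExtension_convexOn {φ : ℝ≥0 → ℝ≥0∞} (hφ : ConvexOn ℝ≥0 Set.univ φ)
    (hmono : Monotone φ) : ConvexOn ℝ≥0 Set.univ (symmetricExtension φ) := by
  refine ⟨convex_univ, fun s _ t _ a b ha hb hab => ?_⟩
  refine le_trans (hmono ?_) (hφ.2 (Set.mem_univ ‖s‖₊) (Set.mem_univ ‖t‖₊) ha hb hab)
  refine (nnnorm_add_le _ _).trans (le_of_eq ?_)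
  simp [NNReal.smul_def, nnnorm_mul]

theorem symmetricExtension_lowerSemicontinuous {φ : ℝ≥0 → ℝ≥0∞} (hφ : LowerSemicontinuous φ) :
    LowerSemicontinuous (symmetricExtension φ) :=
  hφ.comp continuous_nnnorm

end Modulus

/-! ### The proximal average of moduli as an infimum of deviation costs -/

section AverageModulus

variable {ι : Type*} [Fintype ι]

/-- The cost at `t` of the deviations `δ i` from `t`. -/
noncomputable def deviationCost (μ : ℝ) (w : ι → ℝ) (e : ι → ℝ → ℝ≥0∞) (t : ℝ) (δ : ι → ℝ) :
    ℝ≥0∞ :=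
  ∑ i, ENNReal.ofReal (w i) * (e i (t + δ i) + ENNReal.ofReal (μ⁻¹ * δ i ^ 2))

/-- The infimum of the deviation costs over deviations of weighted mean zero. -/
noncomputable def averageModulus (μ : ℝ) (w : ι → ℝ) (e : ι → ℝ → ℝ≥0∞) (t : ℝ) : ℝ≥0∞ :=
  ⨅ δ : {δ : ι → ℝ // ∑ i, w i * δ i = 0}, deviationCost μ w e t δ.1

instance (w : ι → ℝ) : Nonempty {δ : ι → ℝ // ∑ i, w i * δ i = 0} := ⟨⟨0, by simp⟩⟩

variable {μ : ℝ} {w : ι → ℝ} {e : ι → ℝ → ℝ≥0∞}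

theorem averageModulus_le {t : ℝ} {δ : ι → ℝ} (hδ : ∑ i, w i * δ i = 0) :
    averageModulus μ w e t ≤ deviationCost μ w e t δ :=
  iInf_le (fun δ : {δ : ι → ℝ // ∑ i, w i * δ i = 0} => deviationCost μ w e t δ.1) ⟨δ, hδ⟩

theorem le_deviationCost (t : ℝ) (δ : ι → ℝ) (i : ι) :
    ENNReal.ofReal (w i) * (e i (t + δ i) + ENNReal.ofReal (μ⁻¹ * δ i ^ 2)) ≤
      deviationCost μ w e t δ :=
  single_le_sum (f := fun i =>
    ENNReal.ofReal (w i) * (e i (t + δ i) + ENNReal.ofReal (μ⁻¹ * δ i ^ 2)))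
    (fun _ _ => zero_le) (mem_univ i)

theorem averageModulus_neg (he : ∀ i t, e i (-t) = e i t) (t : ℝ) :
    averageModulus μ w e (-t) = averageModulus μ w e t := by
  have key : ∀ t, averageModulus μ w e (-t) ≤ averageModulus μ w e t := by
    intro t
    refine le_iInf fun δ => (averageModulus_le (δ := -δ.1) ?_).trans (le_of_eq ?_)
    · simpa using δ.2
    · refine sum_congr rfl fun i _ => ?_
      rw [Pi.neg_apply, ← neg_add, he, neg_sq]
  exact le_antisymm (key t) (by simpa using key (-t))

theorem averageModulus_zero (he : ∀ i, e i 0 = 0) : averageModulus μ w e 0 = 0 := by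
  refine nonpos_iff_eq_zero.1 ((averageModulus_le (δ := 0) (by simp)).trans ?_)
  simp [deviationCost, he]

theorem deviationCost_lowerSemicontinuous (he : ∀ i, LowerSemicontinuous (e i)) :
    LowerSemicontinuous fun p : ℝ × (ι → ℝ) => deviationCost μ w e p.1 p.2 := by
  refine lowerSemicontinuous_sum fun i _ => ?_
  refine (ENNReal.continuous_const_mul ENNReal.ofReal_ne_top).comp_lowerSemicontinuous ?_
    fun a b h => mul_le_mul_right h _
  refine ((he i).comp (by fun_prop : Continuous fun p : ℝ × (ι → ℝ) => p.1 + p.2 i)).add ?_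
  exact (ENNReal.continuous_ofReal.comp (by fun_prop)).lowerSemicontinuous

theorem norm_le_of_deviationCost_le (hμ : 0 < μ) (hw : ∀ i, 0 < w i) {t : ℝ} {δ : ι → ℝ}
    {c : ℝ≥0} (h : deviationCost μ w e t δ ≤ c) : ‖δ‖ ≤ 1 + ∑ i, c * μ / w i := by
  have hnn : ∀ i, 0 ≤ c * μ / w i := fun i => by have := hw i; positivity
  have hs : 0 ≤ ∑ i, c * μ / w i := sum_nonneg fun i _ => hnn i
  refine (pi_norm_le_iff_of_nonneg (by positivity)).2 fun i => ?_
  have h1 : ENNReal.ofReal (w i * (μ⁻¹ * δ i ^ 2)) ≤ c := by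
    rw [ENNReal.ofReal_mul (hw i).le]
    refine le_trans ?_ ((le_deviationCost t δ i).trans h)
    gcongr
    exact le_add_self
  rw [← ENNReal.ofReal_coe_nnreal, ENNReal.ofReal_le_ofReal_iff c.coe_nonneg] at h1
  have h2 : δ i ^ 2 ≤ c * μ / w i := by
    rw [le_div_iff₀ (hw i)]
    calc δ i ^ 2 * w i = w i * (μ⁻¹ * δ i ^ 2) * μ := by field_simp
      _ ≤ c * μ := by gcongr
  have h3 : c * μ / w i ≤ ∑ i, c * μ / w i := single_le_sum (fun i _ => hnn i) (mem_univ i)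
  rw [Real.norm_eq_abs]
  -- With `S` the sum, `δ i ^ 2 ≤ S ≤ (1 + S) ^ 2`; the `1 +` avoids a square root.
  refine abs_le_of_sq_le_sq ?_ (by positivity)
  nlinarith

/-- Admissible deviations of cost at most `c` lie in a compact set `K` independent of the base
point. On `K` the strict bound `c < cost` at `t` persists near `t` by joint lower semicontinuity. -/
theorem averageModulus_lowerSemicontinuous (hμ : 0 < μ) (hw : ∀ i, 0 < w i)
    (he : ∀ i, LowerSemicontinuous (e i)) : LowerSemicontinuous (averageModulus μ w e) := by
  intro t y hy
  obtain ⟨c, hyc, hct⟩ := ENNReal.lt_iff_exists_nnreal_btwn.1 hy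
  set K : Set (ι → ℝ) :=
    Metric.closedBall 0 (1 + ∑ i, c * μ / w i) ∩ {δ | ∑ i, w i * δ i = 0} with hK
  have hKc : IsCompact K := (isCompact_closedBall _ _).inter_right
    (isClosed_eq (by fun_prop) continuous_const)
  have hev := hKc.eventually_forall_of_forall_eventually (x₀ := t)
    (P := fun s δ => (c : ℝ≥0∞) < deviationCost μ w e s δ) fun δ hδ =>
      deviationCost_lowerSemicontinuous he (t, δ) c (hct.trans_le (averageModulus_le hδ.2))
  filter_upwards [hev] with s hs
  refine hyc.trans_le (le_iInf fun δ => ?_)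
  by_contra! hlt
  exact (hs δ.1 ⟨mem_closedBall_zero_iff.2 (norm_le_of_deviationCost_le hμ hw hlt.le),
    δ.2⟩).not_gt hlt

theorem deviationCost_convex (hμ : 0 < μ) (he : ∀ i, ConvexOn ℝ≥0 Set.univ (e i))
    (s t : ℝ) (δ ε : ι → ℝ) {a b : ℝ≥0} (hab : a + b = 1) :
    deviationCost μ w e (a • s + b • t) (a • δ + b • ε) ≤
      a * deviationCost μ w e s δ + b * deviationCost μ w e t ε := by
  simp only [deviationCost, mul_sum, ← sum_add_distrib]
  refine sum_le_sum fun i _ => ?_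
  have h1 : e i (a • s + b • t + (a • δ + b • ε) i) ≤ a * e i (s + δ i) + b * e i (t + ε i) := by
    have := (he i).2 (Set.mem_univ (s + δ i)) (Set.mem_univ (t + ε i)) (zero_le (a := a))
      (zero_le (a := b)) hab
    simp only [ENNReal.smul_def, smul_eq_mul] at this
    rwa [show a • s + b • t + (a • δ + b • ε) i = a • (s + δ i) + b • (t + ε i) by
      simp only [Pi.add_apply, Pi.smul_apply, NNReal.smul_def, smul_eq_mul]
      ring]
  have h2 : ENNReal.ofReal (μ⁻¹ * (a • δ + b • ε) i ^ 2) ≤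
      a * ENNReal.ofReal (μ⁻¹ * δ i ^ 2) + b * ENNReal.ofReal (μ⁻¹ * ε i ^ 2) := by
    rw [← ENNReal.ofReal_coe_nnreal (p := a), ← ENNReal.ofReal_coe_nnreal (p := b),
      ← ENNReal.ofReal_mul a.coe_nonneg, ← ENNReal.ofReal_mul b.coe_nonneg,
      ← ENNReal.ofReal_add (by positivity) (by positivity)]
    refine ENNReal.ofReal_le_ofReal ?_
    have hb : (b : ℝ) = 1 - a := by rw [← NNReal.coe_one, ← hab]; simp
    have hbn := b.coe_nonneg
    simp only [Pi.add_apply, Pi.smul_apply, NNReal.smul_def, smul_eq_mul]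
    have : (a * δ i + b * ε i) ^ 2 ≤ a * δ i ^ 2 + b * ε i ^ 2 := by
      have := mul_nonneg (mul_nonneg a.coe_nonneg hbn) (sq_nonneg (δ i - ε i))
      rw [hb] at this ⊢
      linarith
    calc μ⁻¹ * (a * δ i + b * ε i) ^ 2 ≤ μ⁻¹ * (a * δ i ^ 2 + b * ε i ^ 2) := by gcongr
      _ = _ := by ring
  calc _ ≤ ENNReal.ofReal (w i) * ((a * e i (s + δ i) + b * e i (t + ε i)) +
        (a * ENNReal.ofReal (μ⁻¹ * δ i ^ 2) + b * ENNReal.ofReal (μ⁻¹ * ε i ^ 2))) := by gcongr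
    _ = _ := by ring

theorem averageModulus_convexOn (hμ : 0 < μ) (he : ∀ i, ConvexOn ℝ≥0 Set.univ (e i)) :
    ConvexOn ℝ≥0 Set.univ (averageModulus μ w e) := by
  refine ⟨convex_univ, fun s _ t _ a b _ _ hab => ?_⟩
  simp only [ENNReal.smul_def, smul_eq_mul]
  unfold averageModulus
  rw [ENNReal.mul_iInf (by simp), ENNReal.mul_iInf (by simp), ENNReal.iInf_add]
  simp only [ENNReal.add_iInf]
  refine le_iInf fun δ => le_iInf fun ε => ?_
  refine le_trans (averageModulus_le ?_) (deviationCost_convex hμ he s t δ.1 ε.1 hab)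
  simp only [Pi.add_apply, Pi.smul_apply, NNReal.smul_def, smul_eq_mul, mul_add, sum_add_distrib,
    mul_left_comm (w _), ← mul_sum, δ.2, ε.2, mul_zero, add_zero]

/-- Either `|δ i| ≥ |t| / 2` and the quadratic penalty is bounded below, or `|t + δ i| ≥ |t| / 2`
and `φ i` is. -/
theorem averageModulus_pos {φ : ι → ℝ≥0 → ℝ≥0∞} (hμ : 0 < μ) (hw : ∀ i, 0 < w i)
    {i : ι} (hφ : Monotone (φ i)) (hφ0 : ∀ t, φ i t = 0 → t = 0) {t : ℝ} (ht : t ≠ 0) :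
    0 < averageModulus μ w (fun i => symmetricExtension (φ i)) t := by
  have ha : 0 < |t| / 2 := by positivity
  have hwi : 0 < ENNReal.ofReal (w i) := ENNReal.ofReal_pos.2 (hw i)
  have h1 : 0 < ENNReal.ofReal (w i) * symmetricExtension (φ i) (|t| / 2) :=
    ENNReal.mul_pos hwi.ne' fun h => ha.ne' (by simpa using hφ0 _ h)
  have h2 : 0 < ENNReal.ofReal (w i) * ENNReal.ofReal (μ⁻¹ * (|t| / 2) ^ 2) :=
    ENNReal.mul_pos hwi.ne' (ENNReal.ofReal_pos.2 (by positivity)).ne'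
  refine (lt_min h1 h2).trans_le (le_iInf fun δ => ?_)
  refine le_trans ?_ (le_deviationCost t δ.1 i)
  rcases le_total (|t| / 2) |δ.1 i| with h | h
  · refine (min_le_right _ _).trans ?_
    rw [← sq_abs (δ.1 i)]
    gcongr
    exact le_add_left (ENNReal.ofReal_le_ofReal (by gcongr))
  · refine (min_le_left _ _).trans ?_
    gcongr
    refine le_add_right (symmetricExtension_le hφ ?_)
    rw [abs_of_pos ha]
    have := abs_sub_abs_le_abs_sub t (-δ.1 i)
    rw [abs_neg, sub_neg_eq_add] at this
    linarith

theorem proximalSum_eq (hμ : 0 < μ) (hw : ∀ i, 0 < w i) (hw1 : ∑ i, w i = 1) (t : ℝ)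
    {δ : ι → ℝ} (hδ : ∑ i, w i * δ i = 0) :
    ∑ i, (w i : EReal) * (((μ / 2 : ℝ) : EReal) * ((e i (t + δ i) : ℝ≥0∞) : EReal) +
        ((1 / 2 * ‖t + δ i‖ ^ 2 : ℝ) : EReal)) =
      ((ENNReal.ofReal (μ / 2) * deviationCost μ w e t δ + ENNReal.ofReal (1 / 2 * t ^ 2) :
        ℝ≥0∞) : EReal) := by
  have hR : ∑ i, ENNReal.ofReal (w i) * ENNReal.ofReal (1 / 2 * (t + δ i) ^ 2) =
      ENNReal.ofReal (μ / 2) * ∑ i, ENNReal.ofReal (w i) * ENNReal.ofReal (μ⁻¹ * δ i ^ 2) +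
        ENNReal.ofReal (1 / 2 * t ^ 2) := by
    have hp : ∀ i, 0 ≤ w i * (μ⁻¹ * δ i ^ 2) := fun i => by have := hw i; positivity
    have hq : ∀ i, 0 ≤ w i * (1 / 2 * (t + δ i) ^ 2) := fun i => by have := hw i; positivity
    simp only [← ENNReal.ofReal_mul (hw _).le]
    rw [← ENNReal.ofReal_sum_of_nonneg fun i _ => hp i,
      ← ENNReal.ofReal_sum_of_nonneg fun i _ => hq i, ← ENNReal.ofReal_mul (by positivity),
      ← ENNReal.ofReal_add (mul_nonneg (by positivity) (sum_nonneg fun i _ => hp i))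
        (by positivity)]
    congr 1
    calc ∑ i, w i * (1 / 2 * (t + δ i) ^ 2)
        = ∑ i, (w i * (1 / 2 * t ^ 2) + t * (w i * δ i) + μ / 2 * (w i * (μ⁻¹ * δ i ^ 2))) :=
          sum_congr rfl fun i _ => by field_simp; ring
      _ = _ := by
        rw [sum_add_distrib, sum_add_distrib, ← sum_mul, ← mul_sum, ← mul_sum, hδ, hw1]
        ring
  have hE : ENNReal.ofReal (μ / 2) * deviationCost μ w e t δ + ENNReal.ofReal (1 / 2 * t ^ 2) =
      ∑ i, ENNReal.ofReal (w i) *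
        (ENNReal.ofReal (μ / 2) * e i (t + δ i) + ENNReal.ofReal (1 / 2 * (t + δ i) ^ 2)) := by
    simp only [deviationCost, mul_add, sum_add_distrib, hR]
    rw [mul_sum, add_assoc]
    simp only [mul_left_comm]
  have hcoe : ∀ r : ℝ, 0 ≤ r → ((ENNReal.ofReal r : ℝ≥0∞) : EReal) = (r : EReal) := fun r hr => by
    rw [EReal.coe_ennreal_ofReal, max_eq_left hr]
  let f : ℝ≥0∞ →+ EReal := ⟨⟨(↑), rfl⟩, EReal.coe_ennreal_add⟩
  rw [hE]
  refine Eq.trans (sum_congr rfl fun i _ => ?_) (map_sum f _ _).symm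
  change _ = ((_ : ℝ≥0∞) : EReal)
  rw [EReal.coe_ennreal_mul, EReal.coe_ennreal_add, EReal.coe_ennreal_mul, hcoe _ (hw i).le,
    hcoe _ (by positivity), hcoe _ (by positivity), Real.norm_eq_abs, sq_abs]

theorem proximalAverage_eq (hμ : 0 < μ) (hw : ∀ i, 0 < w i) (hw1 : ∑ i, w i = 1) (t : ℝ) :
    proximalAverage (μ / 2) (fun i s => ((e i s : ℝ≥0∞) : EReal)) w t =
      ((averageModulus μ w e t : ℝ≥0∞) : EReal) := by
  have hcoe : ∀ r : ℝ, 0 ≤ r → ((ENNReal.ofReal r : ℝ≥0∞) : EReal) = (r : EReal) := fun r hr => by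
    rw [EReal.coe_ennreal_ofReal, max_eq_left hr]
  -- Surjectivity of this change of variables is enough to identify the two infima.
  let g : {z : ι → ℝ // ∑ i, z i = t} → {δ : ι → ℝ // ∑ i, w i * δ i = 0} := fun z =>
    ⟨fun i => (w i)⁻¹ * z.1 i - t, by
      simp only [mul_sub, mul_inv_cancel_left₀ (hw _).ne', sum_sub_distrib, ← sum_mul, hw1, z.2]
      ring⟩
  have hg : Function.Surjective g := fun δ => by
    refine ⟨⟨fun i => w i * (t + δ.1 i), ?_⟩, ?_⟩
    · simp only [mul_add, sum_add_distrib, ← sum_mul, hw1, δ.2]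
      ring
    · ext i
      simp only [g, inv_mul_cancel_left₀ (hw i).ne']
      ring
  have hinf : ⨅ z : {z : ι → ℝ // ∑ i, z i = t}, ∑ i, (w i : EReal) *
      (((μ / 2 : ℝ) : EReal) * ((e i ((w i)⁻¹ • z.1 i) : ℝ≥0∞) : EReal) +
        ((1 / 2 * ‖(w i)⁻¹ • z.1 i‖ ^ 2 : ℝ) : EReal)) =
      ((ENNReal.ofReal (μ / 2) * averageModulus μ w e t + ENNReal.ofReal (1 / 2 * t ^ 2) :
        ℝ≥0∞) : EReal) := by
    unfold averageModulus
    rw [ENNReal.mul_iInf (by simp), ENNReal.iInf_add,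
      Monotone.map_iInf_of_continuousAt (f := ((↑) : ℝ≥0∞ → EReal))
        continuous_coe_ennreal_ereal.continuousAt (fun _ _ => EReal.coe_ennreal_le_coe_ennreal_iff.2) rfl]
    refine hg.iInf_congr _ fun z => ?_
    simp only [Function.comp_apply]
    rw [← proximalSum_eq hμ hw hw1 t (g z).2]
    simp only [g, add_sub_cancel, smul_eq_mul]
  unfold proximalAverage
  rw [hinf, EReal.coe_ennreal_add, EReal.coe_ennreal_mul, hcoe _ (by positivity),
    hcoe _ (by positivity), Real.norm_eq_abs, sq_abs,
    add_comm (((μ / 2 : ℝ) : EReal) * _), ← add_assoc, ← EReal.coe_add]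
  rw [show -(1 / 2) * t ^ 2 + 1 / 2 * t ^ 2 = 0 by ring, EReal.coe_zero, zero_add, ← mul_assoc,
    ← EReal.coe_mul, one_div, inv_mul_cancel₀ (by positivity), EReal.coe_one, one_mul]

end AverageModulus

/-! ### Monotonicity of the resolvent average -/

section Resolvent

variable {H : Type*} [NormedAddCommGroup H] [InnerProductSpace ℝ H] {ι : Type*} [Fintype ι]

theorem exists_of_mem_resolventAverage {μ : ℝ} {A : ι → H → Set H} {w : ι → ℝ} {x u : H}
    (h : u ∈ resolventAverage μ A w x) :
    ∃ z : ι → H, ∑ i, w i • z i = x ∧ ∀ i, u + μ⁻¹ • x - μ⁻¹ • z i ∈ A i (z i) := by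
  obtain ⟨p, hp, q, rfl, rfl⟩ := h
  obtain ⟨g, hg, rfl⟩ := (Set.mem_fintype_sum _ _).1 hp
  choose z hz hzg using hg
  refine ⟨z, sum_congr rfl fun i _ => hzg i, fun i => ?_⟩
  obtain ⟨a, ha, b, rfl, hab⟩ := hz i
  have : a = p - μ⁻¹ • z i := by rw [← hab]; exact (add_sub_cancel_right _ _).symm
  convert ha using 1
  rw [this]
  simp

theorem sum_mul_norm_sub_sq {w : ι → ℝ} (hw1 : ∑ i, w i = 1) (d : ι → H) :
    ∑ i, w i * ‖d i - ∑ j, w j • d j‖ ^ 2 =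
      ∑ i, w i * ‖d i‖ ^ 2 - ‖∑ j, w j • d j‖ ^ 2 := by
  set m := ∑ j, w j • d j with hm
  have h : ∑ i, w i * inner ℝ (d i) m = ‖m‖ ^ 2 := by
    rw [← real_inner_self_eq_norm_sq]
    nth_rw 2 [hm]
    simp only [sum_inner, real_inner_smul_left]
  calc ∑ i, w i * ‖d i - m‖ ^ 2
      = ∑ i, (w i * ‖d i‖ ^ 2 - 2 * (w i * inner ℝ (d i) m) + w i * ‖m‖ ^ 2) :=
        sum_congr rfl fun i _ => by rw [norm_sub_sq_real]; ring
    _ = _ := by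
      rw [sum_add_distrib, sum_sub_distrib, ← mul_sum, h, ← sum_mul, hw1]
      ring

theorem averageModulus_norm_le {μ : ℝ} (hμ : 0 < μ) {w : ι → ℝ}
    (hw1 : ∑ i, w i = 1) {φ : ι → ℝ≥0 → ℝ≥0∞} (hφ : ∀ i, Monotone (φ i)) (d : ι → H) :
    averageModulus μ w (fun i => symmetricExtension (φ i)) ‖∑ j, w j • d j‖ ≤
      ∑ i, ENNReal.ofReal (w i) *
        (φ i ‖d i‖₊ + ENNReal.ofReal (μ⁻¹ * ‖d i - ∑ j, w j • d j‖ ^ 2)) := by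
  set m := ∑ j, w j • d j with hm
  -- If `m = 0`, then `v = 0`, so `‖v‖ ≤ 1` and `⟪v, m⟫ = ‖m‖` hold in all cases.
  set v := ‖m‖⁻¹ • m with hv
  have hv1 : ‖v‖ ≤ 1 := by
    rw [hv, norm_smul, norm_inv, norm_norm]
    exact inv_mul_le_one
  have hvm : inner ℝ v m = ‖m‖ := by
    rw [hv, real_inner_smul_left, real_inner_self_eq_norm_sq]
    rcases eq_or_ne ‖m‖ 0 with h | h
    · simp [h]
    · field_simp
  have hle : ∀ y : H, |inner ℝ v y| ≤ ‖y‖ := fun y =>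
    (abs_real_inner_le_norm v y).trans (mul_le_of_le_one_left (norm_nonneg y) hv1)
  refine (averageModulus_le (δ := fun i => inner ℝ v (d i) - ‖m‖) ?_).trans ?_
  · have : ∑ i, w i * inner ℝ v (d i) = ‖m‖ := by
      rw [← hvm, hm]
      simp only [inner_sum, real_inner_smul_right]
    simp only [mul_sub, sum_sub_distrib, ← sum_mul, hw1, this]
    ring
  · refine sum_le_sum fun i _ => ?_
    have hs : (inner ℝ v (d i) - ‖m‖) ^ 2 ≤ ‖d i - m‖ ^ 2 := by
      rw [← hvm, ← inner_sub_right]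
      exact sq_le_sq.2 (by rw [abs_norm]; exact hle _)
    refine mul_le_mul' le_rfl (add_le_add ?_ (ENNReal.ofReal_le_ofReal (by gcongr)))
    rw [add_sub_cancel]
    refine hφ i ?_
    simpa [← NNReal.coe_le_coe] using hle (d i)

theorem resolventAverage_isMonotoneWithModulus {μ : ℝ} (hμ : 0 < μ) {w : ι → ℝ}
    (hw : ∀ i, 0 < w i) (hw1 : ∑ i, w i = 1) {A : ι → H → Set H} {φ : ι → ℝ≥0 → ℝ≥0∞}
    (hAφ : ∀ i, IsMonotoneWithModulus (A i) (φ i)) (hφ : ∀ i, Monotone (φ i)) :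
    IsMonotoneWithModulus (resolventAverage μ A w)
      (fun t => averageModulus μ w (fun i => symmetricExtension (φ i)) t) := by
  intro x y u v hu hv
  obtain ⟨a, rfl, ha⟩ := exists_of_mem_resolventAverage hu
  obtain ⟨b, rfl, hb⟩ := exists_of_mem_resolventAverage hv
  set x := ∑ i, w i • a i with hx
  set y := ∑ i, w i • b i with hy
  set d : ι → H := fun i => a i - b i with hd
  have hm : x - y = ∑ i, w i • d i := by simp only [hd, smul_sub, sum_sub_distrib, hx, hy]
  set m := ∑ i, w i • d i with hmdef
  -- The elements of `A i (a i)` and `A i (b i)` differ by `q - μ⁻¹ • d i`, with `q` independent of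
  -- `i`.
  set q := u - v + μ⁻¹ • m with hq
  have hφd : ∀ i, ((φ i ‖d i‖₊ : ℝ≥0∞) : EReal) ≤
      ((inner ℝ q (d i) - μ⁻¹ * ‖d i‖ ^ 2 : ℝ) : EReal) := fun i => by
    refine (hAφ i _ _ _ _ (ha i) (hb i)).trans (le_of_eq ?_)
    congr 1
    rw [show u + μ⁻¹ • x - μ⁻¹ • a i - (v + μ⁻¹ • y - μ⁻¹ • b i) = q - μ⁻¹ • d i by
      simp only [hq, ← hm, hd, smul_sub]; abel, inner_sub_left, real_inner_smul_left,
      real_inner_self_eq_norm_sq]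
  have hnn : ∀ i, 0 ≤ inner ℝ q (d i) - μ⁻¹ * ‖d i‖ ^ 2 := fun i => by
    exact_mod_cast (EReal.coe_ennreal_nonneg _).trans (hφd i)
  have hφr : ∀ i, φ i ‖d i‖₊ ≤ ENNReal.ofReal (inner ℝ q (d i) - μ⁻¹ * ‖d i‖ ^ 2) := fun i => by
    rw [← EReal.coe_ennreal_le_coe_ennreal_iff, EReal.coe_ennreal_ofReal, max_eq_left (hnn i)]
    exact hφd i
  have hterm : ∀ i, 0 ≤ w i * (inner ℝ q (d i) - μ⁻¹ * ‖d i‖ ^ 2 + μ⁻¹ * ‖d i - m‖ ^ 2) :=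
    fun i => mul_nonneg (hw i).le (add_nonneg (hnn i) (by positivity))
  have hsum : ∑ i, w i * (inner ℝ q (d i) - μ⁻¹ * ‖d i‖ ^ 2 + μ⁻¹ * ‖d i - m‖ ^ 2) =
      inner ℝ (u - v) m := by
    have h1 : ∑ i, w i * inner ℝ q (d i) = inner ℝ q m := by
      rw [hmdef]
      simp only [inner_sum, real_inner_smul_right]
    calc _ = ∑ i, w i * inner ℝ q (d i) - μ⁻¹ * ∑ i, w i * ‖d i‖ ^ 2 +
          μ⁻¹ * ∑ i, w i * ‖d i - m‖ ^ 2 := by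
          rw [mul_sum, mul_sum, ← sum_sub_distrib, ← sum_add_distrib]
          exact sum_congr rfl fun i _ => by ring
      _ = _ := by
        rw [h1, sum_mul_norm_sub_sq hw1, ← hmdef, hq, inner_add_left, real_inner_smul_left,
          real_inner_self_eq_norm_sq]
        ring
  rw [hm]
  have key : averageModulus μ w (fun i => symmetricExtension (φ i)) ‖m‖ ≤
      ENNReal.ofReal (inner ℝ (u - v) m) := by
    refine (averageModulus_norm_le hμ hw1 hφ d).trans ?_
    rw [← hsum, ENNReal.ofReal_sum_of_nonneg fun i _ => hterm i]
    refine sum_le_sum fun i _ => ?_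
    rw [ENNReal.ofReal_mul (hw i).le, ENNReal.ofReal_add (hnn i) (by positivity)]
    gcongr
    exact hφr i
  have hpos : 0 ≤ inner ℝ (u - v) m := by rw [← hsum]; exact sum_nonneg fun i _ => hterm i
  rw [← EReal.coe_ennreal_le_coe_ennreal_iff, EReal.coe_ennreal_ofReal, max_eq_left hpos] at key
  exact key

end Resolvent

end ResolventAverage

theorem theorem3p14 {H : Type*} [NormedAddCommGroup H] [InnerProductSpace ℝ H] [CompleteSpace H]
    (n : ℕ) (μ : ℝ) (hμ : 0 < μ)
    (w : Fin n → ℝ) (hw : ∀ i, 0 < w i) (hw1 : ∑ i, w i = 1)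
    (A : Fin n → H → Set H) (hA : ∀ i, ResolventAverage.IsMaximallyMonotone (A i))
    (φ : Fin n → ℝ≥0 → ℝ≥0∞)
    (hAφ : ∀ i, ResolventAverage.IsMonotoneWithModulus (A i) (φ i))
    (hlsc : ∀ i, LowerSemicontinuous (φ i))
    (hconv : ∀ i, ConvexOn ℝ≥0 Set.univ (φ i)) :
    ∃ ψ : ℝ≥0 → ℝ≥0∞,
      -- the proximal average of the (symmetrically extended) moduli is the modulus `ψ`
      (∀ t : ℝ, ResolventAverage.proximalAverage (μ / 2)
          (fun i s => ((ResolventAverage.symmetricExtension (φ i) s : ℝ≥0∞) : EReal)) w t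
        = ((ResolventAverage.symmetricExtension ψ t : ℝ≥0∞) : EReal)) ∧
      LowerSemicontinuous (ResolventAverage.symmetricExtension ψ) ∧
      ConvexOn ℝ≥0 Set.univ (ResolventAverage.symmetricExtension ψ) ∧
      ResolventAverage.IsMonotoneWithModulus (ResolventAverage.resolventAverage μ A w) ψ ∧
      ((∃ i₀, ResolventAverage.IsUniformlyMonotone (A i₀) (φ i₀)) →
        ResolventAverage.IsUniformlyMonotone (ResolventAverage.resolventAverage μ A w) ψ) := by
  have h0 : ∀ i, φ i 0 = 0 := fun i => (hAφ i).apply_zero (hA i).exists_mem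
  have hmono : ∀ i, Monotone (φ i) := fun i => ResolventAverage.monotone_of_convexOn (hconv i) (h0 i)
  let e : Fin n → ℝ → ℝ≥0∞ := fun i => ResolventAverage.symmetricExtension (φ i)
  let ψ : ℝ≥0 → ℝ≥0∞ := fun t => ResolventAverage.averageModulus μ w e t
  have hψ : ResolventAverage.symmetricExtension ψ = ResolventAverage.averageModulus μ w e := by
    funext t
    change ResolventAverage.averageModulus μ w e |t| = _
    rcases abs_choice t with h | h <;> rw [h]
    exact ResolventAverage.averageModulus_neg (fun i => ResolventAverage.symmetricExtension_neg (φ i)) t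
  have hAψ : ResolventAverage.IsMonotoneWithModulus (ResolventAverage.resolventAverage μ A w) ψ :=
    ResolventAverage.resolventAverage_isMonotoneWithModulus hμ hw hw1 hAφ hmono
  refine ⟨ψ, fun t => ?_, ?_, ?_, hAψ, ?_⟩
  · rw [hψ]
    exact ResolventAverage.proximalAverage_eq hμ hw hw1 t
  · rw [hψ]
    exact ResolventAverage.averageModulus_lowerSemicontinuous hμ hw fun i =>
      ResolventAverage.symmetricExtension_lowerSemicontinuous (hlsc i)
  · rw [hψ]
    exact ResolventAverage.averageModulus_convexOn hμ fun i => ResolventAverage.symmetricExtension_convexOn (hconv i) (hmono i)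
  · rintro ⟨i, hi⟩
    refine ⟨hAψ, fun t => ⟨fun ht => ?_, ?_⟩⟩
    · by_contra hne
      exact (ResolventAverage.averageModulus_pos hμ hw (hmono i) (fun s => (hi.2 s).1)
        (NNReal.coe_ne_zero.2 hne)).ne' ht
    · rintro rfl
      exact ResolventAverage.averageModulus_zero fun i => by simp [e, ResolventAverage.symmetricExtension, h0]
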